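/- Let $B$ be a complete Boolean algebra satisfying the countable chain condition (ccc): every set of nonzero pairwise disjoint elements of $B$ is countable. For $a\in B$ let $B\restriction a=\{x\in B: x\le a\}$, a complete Boolean algebra with largest element $a$. A sequence $(a_n)_{n\in\mathbb N}$ in a complete Boolean algebra $A$ converges algebraically to $a\in A$ if there is a decreasing sequence $b_0\ge b_1\ge\cdots$ in $A$ with $\bigwedge_n b_n=\mathbf 0$ and $a_n\mathbin{\triangle} a\le b_n$ for all $n$. The order sequential topology $\tau_s$ on $A$ is the topology whose closed sets are the sets that contain the limit of each of their algebraically convergent sequences. A Maharam submeasure on $A$ is a function $\mu:A\to[0,\infty)$ with $\mu(\mathbf 0)=0$, $\mu(x)\le\mu(y)$ whenever $x\le y$, $\mu(x\vee y)\le\mu(x)+\mu(y)$, and $\lim_n\mu(a_n)=0$ for every decreasing sequence $(a_n)$ with $\bigwedge_n a_n=\mathbf 0$; it is strictly positive if $\mu(x)=0$ only for $x=\mathbf 0$. **Decomposition Theorem.** There are disjoint elements $d,m\in B$ with $d\vee m=\mathbf 1$ such that (i) in the space $(B\restriction d,\tau_s)$ the closure of every nonempty open set is the whole space; (ii) the Boolean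 algebra $B\restriction m$ carries a strictly positive Maharam submeasure. Consequently, at least one of the following holds: (a) there is a nonzero $a\in B$ such that $B\restriction a$ carries a strictly positive Maharam submeasure, and there is a Maharam submeasure on $B$ that is not identically zero; (b) every nonempty open set in $(B,\tau_s)$ is dense. -/

import Mathlib

open Set Filter Topology

namespace BoolSeq

/-- The relative algebra `B ↾ a = {x ∈ B : x ≤ a}`, with the lattice operations (including arbitrary
suprema and infima) of the interval, top element `a`, and complement `x ↦ a \ x`. -/
instance relativeAlgebra {B : Type*} [CompleteBooleanAlgebra B] (a : B) :
    CompleteBooleanAlgebra (Iic a) where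
  __ := (Set.Iic.instCompleteLattice : CompleteLattice (Iic a))
  le_sup_inf x y z := by
    apply Subtype.coe_le_coe.1
    exact le_sup_inf (x := (x : B)) (y := (y : B)) (z := (z : B))
  compl x := ⟨a \ (x : B), sdiff_le⟩
  sdiff x y := ⟨(x : B) \ (y : B), sdiff_le.trans x.2⟩
  himp x y := ⟨(y : B) ⊔ a \ (x : B), sup_le y.2 sdiff_le⟩
  inf_compl_le_bot x := by
    apply Subtype.coe_le_coe.1
    change (x : B) ⊓ (a \ (x : B)) ≤ ⊥
    simp
  top_le_sup_compl x := by
    apply Subtype.coe_le_coe.1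
    change a ≤ (x : B) ⊔ (a \ (x : B))
    simp
  sdiff_eq x y := by
    apply Subtype.ext
    change (x : B) \ (y : B) = (x : B) ⊓ (a \ (y : B))
    have hx : (x : B) ⊓ a = x := inf_eq_left.2 x.2
    rw [← inf_sdiff_assoc, hx]
  himp_eq x y := rfl

section

variable {B : Type*} [CompleteBooleanAlgebra B]

/-- The countable chain condition: every antichain (set of nonzero pairwise disjoint elements)
is countable. -/
def CCC (B : Type*) [CompleteBooleanAlgebra B] : Prop :=
  ∀ A : Set B, (∀ x ∈ A, x ≠ ⊥) → (∀ x ∈ A, ∀ y ∈ A, x ≠ y → x ⊓ y = ⊥) → A.Countable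

/-- Algebraic convergence to zero: `a n ≤ b n` for some decreasing `b` with infimum zero. -/
def ConvergesToZero (a : ℕ → B) : Prop :=
  ∃ b : ℕ → B, Antitone b ∧ ⨅ n, b n = ⊥ ∧ ∀ n, a n ≤ b n

/-- Algebraic convergence to `x`: the symmetric differences with `x` converge to zero. -/
def ConvergesTo (a : ℕ → B) (x : B) : Prop :=
  ConvergesToZero fun n => symmDiff (a n) x

/-- `A` contains the limit of every algebraically convergent sequence of elements of `A`. -/
def SeqClosed (A : Set B) : Prop :=
  ∀ (a : ℕ → B) (x : B), (∀ n, a n ∈ A) → ConvergesTo a x → x ∈ A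

theorem ConvergesTo.subseq {a : ℕ → B} {x : B} (h : ConvergesTo a x) {φ : ℕ → ℕ}
    (hφ : StrictMono φ) : ConvergesTo (a ∘ φ) x := by
  obtain ⟨b, hb, h0, hab⟩ := h
  refine ⟨b, hb, h0, fun n => ?_⟩
  exact (hab (φ n)).trans (hb (hφ.id_le n))

theorem SeqClosed.union {A C : Set B} (hA : SeqClosed A) (hC : SeqClosed C) :
    SeqClosed (A ∪ C) := by
  intro a x ha hx
  by_cases h : ∃ᶠ n in atTop, a n ∈ A
  · obtain ⟨φ, hφ, hm⟩ := Filter.extraction_of_frequently_atTop h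
    exact Or.inl (hA _ x hm (hx.subseq hφ))
  · rw [Filter.not_frequently] at h
    obtain ⟨φ, hφ, hm⟩ := Filter.extraction_of_frequently_atTop h.frequently
    exact Or.inr (hC _ x (fun n => (ha (φ n)).resolve_left (hm n)) (hx.subseq hφ))

/-- The order sequential topology `τ_s`: its closed sets are the sets that are closed under limits
of algebraically convergent sequences. -/
abbrev orderSeqTopology (B : Type*) [CompleteBooleanAlgebra B] : TopologicalSpace B :=
  TopologicalSpace.ofClosed {A : Set B | SeqClosed A}
    (fun _ _ ha _ => (ha 0).elim)
    (fun _ hS a x ha hx => Set.mem_sInter.2 fun A hA =>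
      hS hA a x (fun n => Set.mem_sInter.1 (ha n) A hA) hx)
    (fun _ hA _ hC => SeqClosed.union hA hC)

theorem isClosed_orderSeqTopology_iff (A : Set B) :
    IsClosed[orderSeqTopology B] A ↔ SeqClosed A := by
  rw [← @isOpen_compl_iff _ _ (orderSeqTopology B)]
  change SeqClosed Aᶜᶜ ↔ SeqClosed A
  rw [compl_compl]

/-- The closure of `A` in `τ_s` is the smallest superset of `A` that is closed under limits of
algebraically convergent sequences. -/
theorem isLeast_closure_orderSeqTopology (A : Set B) :
    IsLeast {C : Set B | A ⊆ C ∧ SeqClosed C} (closure[orderSeqTopology B] A) := by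
  let := orderSeqTopology B
  refine ⟨⟨subset_closure, (isClosed_orderSeqTopology_iff _).1 isClosed_closure⟩, ?_⟩
  rintro C ⟨hAC, hC⟩
  exact closure_minimal hAC ((isClosed_orderSeqTopology_iff _).2 hC)

/-- In `(B, τ_s)` the closure of every nonempty open set is the whole space. -/
def EveryNonemptyOpenDense (B : Type*) [CompleteBooleanAlgebra B] : Prop :=
  ∀ U : Set B, IsOpen[orderSeqTopology B] U → U.Nonempty →
    closure[orderSeqTopology B] U = Set.univ

/-- A Maharam submeasure on `B`: a nonnegative real valued monotone subadditive function vanishing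
at zero which is continuous along decreasing sequences with infimum zero. -/
structure IsMaharamSubmeasure (μ : B → ℝ) : Prop where
  nonneg : ∀ x, 0 ≤ μ x
  map_bot : μ ⊥ = 0
  mono : ∀ x y, x ≤ y → μ x ≤ μ y
  map_sup_le : ∀ x y, μ (x ⊔ y) ≤ μ x + μ y
  continuous : ∀ a : ℕ → B, Antitone a → ⨅ n, a n = ⊥ → Tendsto (fun n => μ (a n)) atTop (𝓝 0)

/-- `B` carries a strictly positive Maharam submeasure. -/
def CarriesStrictlyPositiveMaharam (B : Type*) [CompleteBooleanAlgebra B] : Prop :=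
  ∃ μ : B → ℝ, IsMaharamSubmeasure μ ∧ ∀ x, μ x = 0 → x = ⊥

end

end BoolSeq

namespace BoolSeq

section

variable {B : Type*} [CompleteBooleanAlgebra B]

/-! Let `d` be the join of all elements lying in the closure of every open set around `⊥`.
Translation by symmetric difference and continuity of `⊓` and `⊔` in each variable make these
elements a closed ideal. Under ccc its join is the limit of an increasing sequence of members, so
`d` itself is a member. Below `d` everything is inseparable from `⊥`, and translation turns this
into density of every nonempty open set.

Below `dᶜ` only `⊥` is inseparable from `⊥`. This separation yields a diagonal property
(`exists_diagonal_convergesToZero`), hence open lower sets form a neighbourhood base at `⊥`. The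
crux is `exists_isLowerNhd_iSup_mem`: joins of `k` elements of a small neighbourhood stay in a
prescribed one, by comparing limits superior along stable subsequences. This gives neighbourhoods `W
n` with threefold joins from `W (n + 1)` in `W n`, and Frink's chaining argument produces a Maharam
submeasure that is nonzero at a given nonzero element. Exhaustion under ccc and a weighted countable
sum make it strictly positive.

For the dichotomy, either `d = ⊤`, or the submeasure below `dᶜ` extends to `B` through `x ↦ x ⊓ dᶜ`.
-/

/-! ### Algebraic convergence and the order sequential topology -/

theorem ConvergesToZero.mono {a b : ℕ → B} (hb : ConvergesToZero b) (h : ∀ n, a n ≤ b n) :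
    ConvergesToZero a := by
  obtain ⟨c, hc, h0, hbc⟩ := hb
  exact ⟨c, hc, h0, fun n => (h n).trans (hbc n)⟩

theorem ConvergesToZero.sup {a b : ℕ → B} (ha : ConvergesToZero a) (hb : ConvergesToZero b) :
    ConvergesToZero fun n => a n ⊔ b n := by
  obtain ⟨c, hc, h0, hac⟩ := ha
  obtain ⟨c', hc', h0', hbc⟩ := hb
  refine ⟨fun n => c n ⊔ c' n, hc.sup hc', ?_, fun n => sup_le_sup (hac n) (hbc n)⟩
  rw [iInf_sup_of_antitone hc hc', h0, h0', sup_bot_eq]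

theorem convergesToZero_bot : ConvergesToZero fun _ : ℕ => (⊥ : B) :=
  ⟨fun _ => ⊥, fun _ _ _ => le_rfl, iInf_const, fun _ => le_rfl⟩

theorem ConvergesToZero.iSup {ι : Type*} [Finite ι] {a : ι → ℕ → B}
    (ha : ∀ i, ConvergesToZero (a i)) : ConvergesToZero fun n => ⨆ i, a i n := by
  classical
  cases nonempty_fintype ι
  have key : ∀ s : Finset ι, ConvergesToZero fun n => s.sup fun i => a i n := by
    intro s
    induction s using Finset.induction_on with
    | empty => simpa using convergesToZero_bot
    | insert i s _ ih => simpa using (ha i).sup ih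
  simpa [Finset.sup_univ_eq_iSup] using key Finset.univ

theorem convergesTo_bot_iff {a : ℕ → B} : ConvergesTo a ⊥ ↔ ConvergesToZero a := by
  simp [ConvergesTo]

theorem convergesTo_const (x : B) : ConvergesTo (fun _ => x) x := by
  simpa [ConvergesTo] using convergesToZero_bot

theorem convergesTo_bot_of_antitone {a : ℕ → B} (ha : Antitone a) (h : ⨅ n, a n = ⊥) :
    ConvergesTo a ⊥ :=
  convergesTo_bot_iff.2 ⟨a, ha, h, fun _ => le_rfl⟩

theorem iInf_sdiff_iSup (s : ℕ → B) : ⨅ n, (⨆ k, s k) \ s n = ⊥ := by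
  rw [← le_bot_iff]
  have h : ⨅ n, (⨆ k, s k) \ s n ≤ (⨆ k, s k) \ ⨆ k, s k := by
    rw [_root_.sdiff_eq, compl_iSup, inf_iInf]
    simp only [_root_.sdiff_eq, le_refl]
  simpa using h

theorem convergesTo_iSup_of_monotone {s : ℕ → B} (hs : Monotone s) :
    ConvergesTo s (⨆ n, s n) := by
  refine ⟨fun n => (⨆ k, s k) \ s n, fun i j h => sdiff_le_sdiff_left (hs h),
    iInf_sdiff_iSup s, fun n => ?_⟩
  exact (symmDiff_of_le (le_iSup s n)).le

theorem symmDiff_inf_le (x y c : B) : symmDiff (x ⊓ c) (y ⊓ c) ≤ symmDiff x y := by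
  rw [← inf_symmDiff_distrib_right]
  exact inf_le_left

theorem symmDiff_sup_le (x y c : B) : symmDiff (x ⊔ c) (y ⊔ c) ≤ symmDiff x y := by
  simp only [symmDiff, _root_.sdiff_eq, compl_sup]
  refine sup_le ?_ ?_
  · refine le_sup_of_le_left ?_
    rw [inf_sup_right]
    refine sup_le (inf_le_inf_left _ inf_le_left) ?_
    rw [inf_left_comm]
    simp
  · refine le_sup_of_le_right ?_
    rw [inf_sup_right]
    refine sup_le (inf_le_inf_left _ inf_le_left) ?_
    rw [inf_left_comm]
    simp

theorem ConvergesTo.inf_const {a : ℕ → B} {x : B} (h : ConvergesTo a x) (c : B) :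
    ConvergesTo (fun n => a n ⊓ c) (x ⊓ c) :=
  ConvergesToZero.mono h fun _ => symmDiff_inf_le _ _ _

theorem ConvergesTo.sup_const {a : ℕ → B} {x : B} (h : ConvergesTo a x) (c : B) :
    ConvergesTo (fun n => a n ⊔ c) (x ⊔ c) :=
  ConvergesToZero.mono h fun _ => symmDiff_sup_le _ _ _

theorem ConvergesTo.symmDiff_const {a : ℕ → B} {x : B} (h : ConvergesTo a x) (c : B) :
    ConvergesTo (fun n => symmDiff (a n) c) (symmDiff x c) := by
  refine ConvergesToZero.mono h fun n => ?_
  rw [symmDiff_symmDiff_symmDiff_comm, symmDiff_self, symmDiff_bot]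

theorem continuous_of_convergesTo {C : Type*} [CompleteBooleanAlgebra C] {f : B → C}
    (hf : ∀ (a : ℕ → B) (x : B), ConvergesTo a x → ConvergesTo (fun n => f (a n)) (f x)) :
    @Continuous _ _ (orderSeqTopology B) (orderSeqTopology C) f := by
  let := orderSeqTopology B
  let := orderSeqTopology C
  refine continuous_iff_isClosed.2 fun A hA => ?_
  rw [isClosed_orderSeqTopology_iff] at hA ⊢
  exact fun a x ha hx => hA _ _ ha (hf a x hx)

attribute [local instance] orderSeqTopology

theorem continuous_inf_const (c : B) : Continuous fun x : B => x ⊓ c :=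
  continuous_of_convergesTo fun _ _ h => h.inf_const c

theorem continuous_sup_const (c : B) : Continuous fun x : B => x ⊔ c :=
  continuous_of_convergesTo fun _ _ h => h.sup_const c

theorem continuous_symmDiff_const (c : B) : Continuous fun x : B => symmDiff x c :=
  continuous_of_convergesTo fun _ _ h => h.symmDiff_const c

theorem ConvergesTo.mem_of_isClosed {A : Set B} (hA : IsClosed A) {a : ℕ → B} {x : B}
    (h : ConvergesTo a x) (ha : ∀ n, a n ∈ A) : x ∈ A :=
  (isClosed_orderSeqTopology_iff A).1 hA a x ha h

/-- Otherwise a subsequence stays in the closed complement, which would then contain the limit. -/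
theorem ConvergesTo.eventually_mem {U : Set B} (hU : IsOpen U) {a : ℕ → B} {x : B}
    (h : ConvergesTo a x) (hx : x ∈ U) : ∀ᶠ n in atTop, a n ∈ U := by
  by_contra hn
  rw [Filter.not_eventually] at hn
  obtain ⟨φ, hφ, hm⟩ := Filter.extraction_of_frequently_atTop hn
  exact (h.subseq hφ).mem_of_isClosed hU.isClosed_compl hm hx

theorem iSup_mem_of_isClosed {A : Set B} (hA : IsClosed A) {s : ℕ → B}
    (hs : ∀ n, partialSups s n ∈ A) : ⨆ n, s n ∈ A := by
  rw [← iSup_partialSups_eq]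
  exact (convergesTo_iSup_of_monotone (partialSups s).monotone).mem_of_isClosed hA hs

/-- The joins of a sequence chosen one term at a time can be kept inside an open set. -/
theorem exists_iSup_mem_closure {U : Set B} (hU : IsOpen U) (h0 : ⊥ ∈ U) {b : ℕ → ℕ → B}
    (hb : ∀ n, ConvergesTo (b n) ⊥) : ∃ f : ℕ → ℕ, ⨆ n, b n (f n) ∈ closure U := by
  have step : ∀ (n : ℕ) (x : U), ∃ k, (x : B) ⊔ b n k ∈ U := by
    intro n x
    have := ((hb n).sup_const (x : B)).eventually_mem hU (by simp)
    obtain ⟨k, hk⟩ := this.exists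
    exact ⟨k, by rwa [sup_comm]⟩
  choose g hg using step
  let s : ℕ → U := fun n => Nat.rec ⟨⊥, h0⟩ (fun n x => ⟨(x : B) ⊔ b n (g n x), hg n x⟩) n
  refine ⟨fun n => g n (s n), ?_⟩
  have hs : ∀ n, partialSups (fun n => b n (g n (s n))) n = (s (n + 1) : B) := by
    intro n
    induction n with
    | zero => simp [s]
    | succ n ih => rw [partialSups_add_one, ih]; rfl
  refine iSup_mem_of_isClosed isClosed_closure fun n => subset_closure ?_
  rw [hs]
  exact (s (n + 1)).2

/-! ### Countable subfamilies with the same join or meet -/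

/-- A maximal antichain of elements lying below members of `S` is countable; one member of `S` above
each of its elements suffices, since any remainder would enlarge the antichain. -/
theorem CCC.exists_iSup_eq (hB : CCC B) {S : Set B} (hS : S.Nonempty) :
    ∃ t : ℕ → B, (∀ n, t n ∈ S) ∧ ⨆ n, t n = sSup S := by
  obtain ⟨A, hA⟩ := zorn_subset
    {A : Set B | (∀ x ∈ A, x ≠ ⊥) ∧ (∀ x ∈ A, ∀ y ∈ A, x ≠ y → x ⊓ y = ⊥) ∧
      ∀ x ∈ A, ∃ s ∈ S, x ≤ s} (by
    intro c hc hchain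
    refine ⟨⋃₀ c, ⟨?_, ?_, ?_⟩, fun s hs => subset_sUnion_of_mem hs⟩
    · rintro x ⟨s, hs, hx⟩
      exact (hc hs).1 x hx
    · rintro x ⟨s, hs, hx⟩ y ⟨s', hs', hy⟩
      obtain h | h := hchain.total hs hs'
      · exact (hc hs').2.1 x (h hx) y hy
      · exact (hc hs).2.1 x hx y (h hy)
    · rintro x ⟨s, hs, hx⟩
      exact (hc hs).2.2 x hx)
  obtain ⟨⟨h1, h2, h3⟩, hmax⟩ := hA
  choose! g hgS hg using h3
  obtain ⟨s₀, hs₀⟩ := hS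
  -- Adding `s₀` keeps the family nonempty, so that it can be enumerated by `ℕ` even when the
  -- antichain is empty.
  have hc : (insert s₀ (g '' A)).Countable := ((hB A h1 h2).image g).insert _
  obtain ⟨t, ht⟩ := hc.exists_eq_range (insert_nonempty _ _)
  have htS : ∀ n, t n ∈ S := by
    intro n
    have : t n ∈ insert s₀ (g '' A) := ht ▸ mem_range_self n
    rcases this with h | ⟨x, hx, h⟩
    · rwa [h]
    · rw [← h]; exact hgS x hx
  refine ⟨t, htS, le_antisymm (iSup_le fun n => le_sSup (htS n)) (sSup_le fun s hs => ?_)⟩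
  by_contra hle
  have hA' : ∀ x ∈ A, x ≤ ⨆ n, t n := by
    intro x hx
    obtain ⟨n, hn⟩ : g x ∈ range t := ht ▸ mem_insert_of_mem _ (mem_image_of_mem g hx)
    exact (hg x hx).trans (hn ▸ le_iSup t n)
  have hdisj : ∀ x ∈ A, x ⊓ (s \ ⨆ n, t n) = ⊥ := fun x hx =>
    (disjoint_sdiff_self_right.mono_left (hA' x hx)).eq_bot
  have hne : s \ ⨆ n, t n ≠ ⊥ := fun h => hle (sdiff_eq_bot_iff.1 h)
  have hmem : s \ ⨆ n, t n ∈ A := by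
    refine hmax (y := insert (s \ ⨆ n, t n) A) ⟨?_, ?_, ?_⟩ (subset_insert _ _)
      (mem_insert _ _)
    · rintro x (rfl | hx)
      exacts [hne, h1 x hx]
    · rintro x (rfl | hx) y (rfl | hy) hxy
      · exact (hxy rfl).elim
      · rw [inf_comm]; exact hdisj y hy
      · exact hdisj x hx
      · exact h2 x hx y hy hxy
    · rintro x (rfl | hx)
      exacts [⟨s, hs, sdiff_le⟩, ⟨g x, hgS x hx, hg x hx⟩]
  exact hne (by simpa using hdisj _ hmem)

theorem CCC.exists_iInf_eq (hB : CCC B) {ι : Type*} [Nonempty ι] (g : ι → B) :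
    ∃ t : ℕ → ι, ⨅ n, g (t n) = ⨅ i, g i := by
  obtain ⟨s, hs, h⟩ := hB.exists_iSup_eq (S := range fun i => (g i)ᶜ) (range_nonempty _)
  choose t ht using hs
  refine ⟨t, compl_injective ?_⟩
  rw [compl_iInf, compl_iInf, ← sSup_range, ← sSup_range, ← h, ← sSup_range]
  simp only [ht]

/-! ### The dense part -/

/-- The elements that cannot be separated from `⊥`: those in the closure of every open set
containing `⊥`. -/
def inseparableFromBot (B : Type*) [CompleteBooleanAlgebra B] : Set B :=
  {x | ∀ U : Set B, IsOpen U → ⊥ ∈ U → x ∈ closure U}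

theorem isClosed_inseparableFromBot : IsClosed (inseparableFromBot B) := by
  have : inseparableFromBot B = ⋂ (U : Set B) (_ : IsOpen U) (_ : ⊥ ∈ U), closure U := by
    ext; simp [inseparableFromBot]
  rw [this]
  exact isClosed_iInter fun _ => isClosed_iInter fun _ => isClosed_iInter fun _ =>
    isClosed_closure

theorem map_mem_inseparableFromBot {C : Type*} [CompleteBooleanAlgebra C] {f : B → C}
    (hf : Continuous f) (h0 : f ⊥ = ⊥) {x : B} (hx : x ∈ inseparableFromBot B) :
    f x ∈ inseparableFromBot C := by
  intro U hU hbot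
  have := hx (f ⁻¹' U) (hU.preimage hf) (by simpa [h0] using hbot)
  exact closure_mono (image_preimage_subset f U)
    (image_closure_subset_closure_image hf (mem_image_of_mem f this))

theorem inseparableFromBot_of_le {x y : B} (hx : x ∈ inseparableFromBot B) (hy : y ≤ x) :
    y ∈ inseparableFromBot B := by
  have := map_mem_inseparableFromBot (continuous_inf_const y) (by simp) hx
  simpa [inf_eq_right.2 hy] using this

theorem symmDiff_mem_closure {U : Set B} (hU : IsOpen U) {u y : B} (hu : u ∈ U)
    (hy : y ∈ inseparableFromBot B) : symmDiff y u ∈ closure U := by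
  have h := hy ((fun x => symmDiff x u) ⁻¹' U) (hU.preimage (continuous_symmDiff_const u))
    (by simpa using hu)
  exact closure_mono (image_preimage_subset _ U)
    (image_closure_subset_closure_image (continuous_symmDiff_const u) (mem_image_of_mem _ h))

/-- For `u ∈ U`, the join `u ⊔ y` is the translate of `u` by the inseparable element `y \ u`, so
joining with `y` maps `U`, hence its closure, into `closure U`. -/
theorem sup_mem_inseparableFromBot {x y : B} (hx : x ∈ inseparableFromBot B)
    (hy : y ∈ inseparableFromBot B) : x ⊔ y ∈ inseparableFromBot B := by
  intro U hU h0
  have hsub : U ⊆ (fun z => z ⊔ y) ⁻¹' closure U := by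
    intro u hu
    have h := symmDiff_mem_closure hU hu (inseparableFromBot_of_le hy (sdiff_le : y \ u ≤ y))
    rwa [disjoint_sdiff_self_left.symmDiff_eq_sup, sup_comm, sup_sdiff_self_right] at h
  exact closure_minimal hsub (isClosed_closure.preimage (continuous_sup_const y)) (hx U hU h0)

theorem sSup_mem_inseparableFromBot (hB : CCC B) :
    sSup (inseparableFromBot B) ∈ inseparableFromBot B := by
  obtain ⟨t, ht, h⟩ := hB.exists_iSup_eq (S := inseparableFromBot B)
    ⟨⊥, fun U _ h0 => subset_closure h0⟩
  rw [← h]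
  refine iSup_mem_of_isClosed isClosed_inseparableFromBot fun n => ?_
  induction n with
  | zero => simpa using ht 0
  | succ n ih =>
    rw [partialSups_add_one]
    exact sup_mem_inseparableFromBot ih (ht _)

theorem everyNonemptyOpenDense_of_top_mem (h : ⊤ ∈ inseparableFromBot B) :
    EveryNonemptyOpenDense B := by
  rintro U hU ⟨u, hu⟩
  refine eq_univ_of_forall fun x => ?_
  have := symmDiff_mem_closure hU hu (inseparableFromBot_of_le h (le_top : symmDiff x u ≤ ⊤))
  rwa [symmDiff_symmDiff_cancel_right] at this

/-! ### Lower neighbourhoods of `⊥` when every nonzero element is separated from `⊥` -/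

/-- The meet `e` over all selections is inseparable from `⊥`: inside `e`, some selection has its
join in `closure U`, and that join is `e`. Hence `e = ⊥`, and ccc reduces the meet to countably many
selections. -/
theorem exists_diagonal_convergesToZero (hB : CCC B) (hsep : inseparableFromBot B ⊆ {⊥})
    {b : ℕ → ℕ → B} (hb : ∀ n, Antitone (b n)) (hb0 : ∀ n, ⨅ k, b n k = ⊥) :
    ∃ f : ℕ → ℕ, ConvergesToZero fun n => b n (f n) := by
  set e : B := ⨅ f : ℕ → ℕ, ⨆ n, b n (f n) with he
  have he0 : e = ⊥ := by
    refine hsep fun U hU h0 => ?_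
    obtain ⟨f, hf⟩ := exists_iSup_mem_closure hU h0 (b := fun n k => b n k ⊓ e) fun n => by
      simpa using (convergesTo_bot_of_antitone (hb n) (hb0 n)).inf_const e
    rwa [← iSup_inf_eq, inf_eq_right.2 (iInf_le _ f)] at hf
  obtain ⟨t, ht⟩ := hB.exists_iInf_eq fun f : ℕ → ℕ => ⨆ n, b n (f n)
  rw [← he, he0] at ht
  -- The pointwise maximum of the first `n + 1` selections eventually dominates each selection, so
  -- the tail joins have meet `⊥`.
  refine ⟨fun n => (Finset.range (n + 1)).sup fun i => t i n,
    fun m => ⨆ n, b (m + n) ((Finset.range (m + n + 1)).sup fun i => t i (m + n)), ?_, ?_, ?_⟩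
  · intro m m' h
    refine iSup_le fun n => ?_
    obtain ⟨j, rfl⟩ := Nat.exists_eq_add_of_le h
    rw [add_assoc]
    exact le_iSup (fun n => b (m + n) ((Finset.range (m + n + 1)).sup fun i => t i (m + n))) (j + n)
  · refine le_bot_iff.1 (ht ▸ le_iInf fun i => iInf_le_of_le i (iSup_le fun n => ?_))
    refine le_iSup_of_le (i + n) (hb _ ?_)
    exact Finset.le_sup (f := fun j => t j (i + n)) (by simp)
  · intro m
    exact le_iSup (fun n => b (m + n) ((Finset.range (m + n + 1)).sup fun i => t i (m + n))) 0

/-- The limits of algebraically convergent sequences of elements of `A`. -/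
def seqLimits (A : Set B) : Set B :=
  {x | ∃ a : ℕ → B, (∀ n, a n ∈ A) ∧ ConvergesTo a x}

/-- The diagonal property merges a sequence of limits into a single convergent sequence, so one
sequential step already gives a closed set. -/
theorem isClosed_seqLimits (hB : CCC B) (hsep : inseparableFromBot B ⊆ {⊥}) (A : Set B) :
    IsClosed (seqLimits A) := by
  rw [isClosed_orderSeqTopology_iff]
  intro y x hy hx
  choose a ha b hb hb0 hab using hy
  obtain ⟨f, hf⟩ := exists_diagonal_convergesToZero hB hsep hb hb0
  refine ⟨fun n => a n (f n), fun n => ha _ _, ConvergesToZero.mono (hf.sup hx) fun n => ?_⟩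
  exact (symmDiff_triangle _ (y n) _).trans (sup_le_sup_right (hab _ _) _)

/-- An open lower set containing `⊥`. -/
structure IsLowerNhd (U : Set B) : Prop where
  isOpen : IsOpen U
  isLowerSet : IsLowerSet U
  bot_mem : ⊥ ∈ U

theorem IsLowerNhd.univ : IsLowerNhd (univ : Set B) :=
  ⟨isOpen_univ, isLowerSet_univ, mem_univ _⟩

theorem IsLowerNhd.inter {U V : Set B} (hU : IsLowerNhd U) (hV : IsLowerNhd V) :
    IsLowerNhd (U ∩ V) :=
  ⟨hU.isOpen.inter hV.isOpen, hU.isLowerSet.inter hV.isLowerSet, hU.bot_mem, hV.bot_mem⟩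

/-- Remove from the space the limits of sequences in the upward closure of `Uᶜ`. The limit set is
closed and upward closed, and it omits `⊥` because `Uᶜ` is closed. -/
theorem exists_isLowerNhd_subset (hB : CCC B) (hsep : inseparableFromBot B ⊆ {⊥}) {U : Set B}
    (hU : IsOpen U) (h0 : ⊥ ∈ U) : ∃ V, IsLowerNhd V ∧ V ⊆ U := by
  set A : Set B := {x | ∃ y ≤ x, y ∉ U} with hA
  refine ⟨(seqLimits A)ᶜ, ⟨(isClosed_seqLimits hB hsep A).isOpen_compl, ?_, ?_⟩, ?_⟩
  · rintro x y hyx hx ⟨a, ha, hay⟩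
    refine hx ⟨fun n => a n ⊔ x, fun n => ?_, ?_⟩
    · obtain ⟨z, hz, hzU⟩ := ha n
      exact ⟨z, hz.trans le_sup_left, hzU⟩
    · simpa [sup_eq_right.2 hyx] using hay.sup_const x
  · rintro ⟨a, ha, ha0⟩
    choose y hy hyU using ha
    have : ConvergesTo y ⊥ := convergesTo_bot_iff.2 ((convergesTo_bot_iff.1 ha0).mono hy)
    exact this.mem_of_isClosed hU.isClosed_compl hyU h0
  · intro x hx
    by_contra hxU
    exact hx ⟨fun _ => x, fun _ => ⟨x, le_rfl, hxU⟩, convergesTo_const x⟩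

theorem IsLowerNhd.exists_sup_mem (hB : CCC B) (hsep : inseparableFromBot B ⊆ {⊥}) {U : Set B}
    (hU : IsLowerNhd U) {S : Set B} (hS : S.Finite) (hSU : S ⊆ U) :
    ∃ V, IsLowerNhd V ∧ ∀ s ∈ S, ∀ v ∈ V, s ⊔ v ∈ U := by
  induction S, hS using Set.Finite.induction_on with
  | empty => exact ⟨Set.univ, IsLowerNhd.univ, by simp⟩
  | @insert s S _ _ ih =>
    obtain ⟨V, hV, h⟩ := ih ((subset_insert _ _).trans hSU)
    obtain ⟨W, hW, h'⟩ := exists_isLowerNhd_subset hB hsep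
      (hU.isOpen.preimage (continuous_sup_const s)) (by simpa using hSU (mem_insert _ _))
    refine ⟨V ∩ W, hV.inter hW, ?_⟩
    rintro x (rfl | hx) v ⟨hv, hw⟩
    · rw [sup_comm]; exact h' hw
    · exact h x hx v hv

/-- The joins of two elements of `U`. -/
def joins (U : Set B) : Set B := {x | ∃ u ∈ U, ∃ v ∈ U, x = u ⊔ v}

theorem isLowerNhd_joins {U : Set B} (hU : IsLowerNhd U) : IsLowerNhd (joins U) := by
  refine ⟨?_, ?_, ⟨⊥, hU.bot_mem, ⊥, hU.bot_mem, by simp⟩⟩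
  -- For a lower set, joins and symmetric differences of pairs form the same set, a union of
  -- translates of `U`.
  · have : joins U = ⋃ u ∈ U, (fun z => symmDiff z u) ⁻¹' U := by
      ext x
      simp only [mem_iUnion, mem_preimage, exists_prop]
      constructor
      · rintro ⟨u, hu, v, hv, rfl⟩
        refine ⟨u, hu, hU.isLowerSet ?_ hv⟩
        rw [symmDiff_of_ge le_sup_left, sup_sdiff_left_self]
        exact sdiff_le
      · rintro ⟨u, hu, h⟩
        refine ⟨x ⊓ u, hU.isLowerSet inf_le_right hu, x \ u,
          hU.isLowerSet le_sup_left h, (sup_inf_sdiff x u).symm⟩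
    rw [this]
    exact isOpen_biUnion fun u _ => hU.isOpen.preimage (continuous_symmDiff_const u)
  · rintro x y hyx ⟨u, hu, v, hv, rfl⟩
    refine ⟨y ⊓ u, hU.isLowerSet inf_le_right hu, y ⊓ v, hU.isLowerSet inf_le_right hv, ?_⟩
    rw [← inf_sup_left, inf_eq_left.2 hyx]

/-- The translate of `U` by `x` is a neighbourhood of `x`, so it meets `U` at some `z`, and `x ≤ z ⊔
symmDiff z x`. -/
theorem closure_subset_joins {U : Set B} (hU : IsLowerNhd U) : closure U ⊆ joins U := by
  intro x hx
  obtain ⟨z, hz, hzU⟩ := mem_closure_iff.1 hx _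
    (hU.isOpen.preimage (continuous_symmDiff_const x)) (by simpa using hU.bot_mem)
  refine (isLowerNhd_joins hU).isLowerSet (?_ : x ≤ z ⊔ symmDiff z x) ⟨z, hzU, _, hz, rfl⟩
  rw [symmDiff, ← sup_assoc, sup_right_comm, sup_sdiff_self_right]
  exact le_sup_of_le_left le_sup_right

/-! ### Stable subsequences -/

/-- In a countably closed preorder, a monotone map to a ccc algebra is constant below some
element. -/
theorem CCC.exists_le_forall_le_eq (hB : CCC B) {P : Type*} [Preorder P]
    (hP : ∀ u : ℕ → P, Antitone u → ∃ w, ∀ n, w ≤ u n) {L : P → B} (hL : Monotone L) (p₀ : P) :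
    ∃ p ≤ p₀, ∀ q ≤ p, L q = L p := by
  -- Steps of `r` strictly decrease `L`, so an `r`-maximal element is one below which `L` is
  -- constant.
  let r : Iic p₀ → Iic p₀ → Prop := fun p q => p = q ∨ (q ≤ p ∧ L q < L p)
  have rtrans : ∀ {a b c : Iic p₀}, r a b → r b c → r a c := by
    rintro a b c (rfl | ⟨h, h'⟩) (rfl | ⟨k, k'⟩)
    · exact Or.inl rfl
    · exact Or.inr ⟨k, k'⟩
    · exact Or.inr ⟨h, h'⟩
    · exact Or.inr ⟨k.trans h, k'.trans h'⟩
  have rle : ∀ {a b : Iic p₀}, r a b → b ≤ a := by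
    rintro a b (rfl | ⟨h, -⟩)
    exacts [le_rfl, h]
  have hchain : ∀ c, IsChain r c → ∃ ub, ∀ a ∈ c, r a ub := by
    intro c hc
    rcases c.eq_empty_or_nonempty with rfl | hne
    · exact ⟨⟨p₀, le_rfl⟩, by simp⟩
    have := hne.to_subtype
    by_cases hlast : ∃ p ∈ c, ∀ q ∈ c, r q p
    · obtain ⟨p, -, h⟩ := hlast
      exact ⟨p, h⟩
    push Not at hlast
    have hnext : ∀ p ∈ c, ∃ q ∈ c, L q < L p := by
      intro p hp
      obtain ⟨q, hq, hqp⟩ := hlast p hp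
      have hpq : p ≠ q := fun h => hqp (Or.inl h.symm)
      rcases hc hp hq hpq with (h | ⟨-, h⟩) | h
      · exact (hpq h).elim
      · exact ⟨q, hq, h⟩
      · exact (hqp h).elim
    obtain ⟨t, ht⟩ := hB.exists_iInf_eq fun p : c => L (p : Iic p₀)
    have hstep : ∀ (x y : c), ∃ z : c, r x z ∧ r y z := by
      intro x y
      by_cases hxy : (x : Iic p₀) = y
      · exact ⟨x, Or.inl rfl, Or.inl hxy.symm⟩
      · rcases hc x.2 y.2 hxy with h | h
        exacts [⟨y, h, Or.inl rfl⟩, ⟨x, Or.inl rfl, h⟩]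
    choose g hg1 hg2 using hstep
    let u : ℕ → c := fun n => Nat.rec (t 0) (fun n x => g x (t (n + 1))) n
    have hu : Antitone fun n : ℕ => (u n).1.1 := by
      refine antitone_nat_of_succ_le fun n => ?_
      exact rle (hg1 (u n) (t (n + 1)))
    have hut : ∀ n, (u n).1.1 ≤ (t n).1.1 := by
      rintro (_ | n)
      · exact le_rfl
      · exact rle (hg2 (u n) (t (n + 1)))
    obtain ⟨w, hw⟩ := hP _ hu
    refine ⟨⟨w, (hw 0).trans (u 0).1.2⟩, fun p hp => Or.inr ?_⟩
    obtain ⟨q, hq, hqp⟩ := hnext p hp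
    -- The chain has no last element, so `L p` is not below the meet of the chain; hence some `t n`
    -- lies past `p`, and `w` bounds the chain.
    obtain ⟨n, hn⟩ : ∃ n, ¬ L p ≤ L (t n : Iic p₀) := by
      by_contra! h
      have h1 : L p ≤ ⨅ p : c, L (p : Iic p₀) := ht ▸ le_iInf h
      exact hqp.not_ge (h1.trans (iInf_le (fun p : c => L (p : Iic p₀)) ⟨q, hq⟩))
    have hwt : w ≤ (t n : Iic p₀) := (hw n).trans (hut n)
    have hpt : r p (t n) := by
      by_cases hpt : p = t n
      · exact Or.inl hpt
      · exact (hc hp (t n).2 hpt).resolve_right fun h => hn (hL (rle h))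
    refine ⟨hwt.trans (rle hpt), lt_of_le_of_lt (hL hwt) ?_⟩
    rcases hpt with h | h
    · exact (hn (h ▸ le_rfl)).elim
    · exact h.2
  obtain ⟨m, hm⟩ := exists_maximal_of_chains_bounded hchain rtrans
  refine ⟨m, m.2, fun q hq => ?_⟩
  by_contra hne
  have hlt : L q < L m := lt_of_le_of_ne (hL hq) hne
  rcases hm ⟨q, hq.trans m.2⟩ (Or.inr ⟨hq, hlt⟩) with h | ⟨-, h⟩
  · exact hne (congrArg (fun x : Iic p₀ => L x) h)
  · exact lt_asymm hlt h

/-- The limit superior of `x` along the infinite set `A`. -/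
def limsupOn (x : ℕ → B) (A : Set ℕ) : B := ⨅ m : ℕ, ⨆ n ∈ {n ∈ A | m ≤ n}, x n

theorem limsupOn_mono (x : ℕ → B) {A A' : Set ℕ} (h : (A' \ A).Finite) :
    limsupOn x A' ≤ limsupOn x A := by
  obtain ⟨N, hN⟩ := h.bddAbove
  refine le_iInf fun m => iInf_le_of_le (max m (N + 1)) (iSup₂_le fun n hn => ?_)
  refine le_iSup₂_of_le n ⟨?_, (le_max_left _ _).trans hn.2⟩ le_rfl
  by_contra hA
  have := hN ⟨hn.1, hA⟩
  have := (le_max_right m (N + 1)).trans hn.2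
  omega

/-- Infinite sets of natural numbers, preordered by inclusion up to finite sets. -/
structure InfiniteSet where
  carrier : Set ℕ
  infinite : carrier.Infinite

instance : Preorder InfiniteSet where
  le A A' := (A.carrier \ A'.carrier).Finite
  le_refl A := by simp
  le_trans A A' A'' h h' := (h.union h').subset fun n hn => by
    by_cases hA : n ∈ A'.carrier
    exacts [Or.inr ⟨hA, hn.2⟩, Or.inl ⟨hn.1, hA⟩]

/-- The usual pseudo-intersection: pick the `n`-th point from the first `n + 1` sets, increasing
strictly. -/
theorem InfiniteSet.exists_le (u : ℕ → InfiniteSet) (hu : Antitone u) : ∃ w, ∀ n, w ≤ u n := by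
  have hinf : ∀ n N : ℕ, ∃ k, N < k ∧ ∀ i ≤ n, k ∈ (u i).carrier := by
    intro n N
    have hfin : (⋃ i ∈ Iic n, (u n).carrier \ (u i).carrier).Finite :=
      (finite_Iic n).biUnion fun i hi => hu hi
    obtain ⟨k, hk, hkN⟩ := ((u n).infinite.sdiff hfin).exists_gt N
    refine ⟨k, hkN, fun i hi => ?_⟩
    by_contra hki
    exact hk.2 (mem_biUnion (x := i) hi ⟨hk.1, hki⟩)
  choose g hg hg' using hinf
  let s : ℕ → ℕ := fun n => Nat.rec (g 0 0) (fun n x => g (n + 1) x) n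
  have hs : StrictMono s := strictMono_nat_of_lt_succ fun n => hg (n + 1) (s n)
  have hmem : ∀ n i, i ≤ n → s n ∈ (u i).carrier := by
    rintro (_ | n) i hi
    exacts [hg' 0 0 i hi, hg' (n + 1) (s n) i hi]
  refine ⟨⟨range s, infinite_range_of_injective hs.injective⟩, fun i => ?_⟩
  refine ((finite_Iio i).image s).subset ?_
  rintro _ ⟨⟨n, rfl⟩, hn⟩
  exact mem_image_of_mem s (lt_of_not_ge fun h => hn (hmem n i h))

/-- Stability for one coordinate passes to smaller infinite sets, so the finitely many coordinates
can be treated one after another. -/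
theorem CCC.exists_stable (hB : CCC B) {ι : Type*} [Finite ι] (x : ι → ℕ → B) :
    ∃ A : Set ℕ, A.Infinite ∧ ∀ i, ∀ A' ⊆ A, A'.Infinite →
      limsupOn (x i) A' = limsupOn (x i) A := by
  classical
  cases nonempty_fintype ι
  have hmono : ∀ i, Monotone fun A : InfiniteSet => limsupOn (x i) A.carrier :=
    fun i A A' h => limsupOn_mono (x i) h
  have key : ∀ s : Finset ι, ∃ A : InfiniteSet, ∀ i ∈ s, ∀ A' ≤ A,
      limsupOn (x i) A'.carrier = limsupOn (x i) A.carrier := by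
    intro s
    induction s using Finset.induction_on with
    | empty => exact ⟨⟨Set.univ, infinite_univ⟩, by simp⟩
    | insert i s _ ih =>
      obtain ⟨A, hA⟩ := ih
      obtain ⟨A₁, h₁, h⟩ := hB.exists_le_forall_le_eq InfiniteSet.exists_le (hmono i) A
      refine ⟨A₁, fun j hj A' hA' => ?_⟩
      rcases Finset.mem_insert.1 hj with rfl | hj
      · exact h A' hA'
      · exact (hA j hj A' (hA'.trans h₁)).trans (hA j hj A₁ h₁).symm
  obtain ⟨A, hA⟩ := key Finset.univ
  refine ⟨A.carrier, A.infinite, fun i A' h hinf => hA i (Finset.mem_univ i) ⟨A', hinf⟩ ?_⟩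
  change (A' \ A.carrier).Finite
  simp [sdiff_eq_empty.2 h]

theorem limsupOn_le_iSup (x : ℕ → B) (A : Set ℕ) : limsupOn x A ≤ ⨆ n ∈ A, x n :=
  iInf_le_of_le 0 (iSup₂_le fun n hn => le_iSup₂_of_le n hn.1 le_rfl)

theorem convergesToZero_sdiff_limsupOn (x : ℕ → B) {A : Set ℕ} {φ : ℕ → ℕ} (hφ : StrictMono φ)
    (hA : ∀ n, φ n ∈ A) : ConvergesToZero fun n => x (φ n) \ limsupOn x A := by
  refine ⟨fun m => (⨆ n ∈ {n ∈ A | m ≤ n}, x n) \ limsupOn x A, fun m m' h => ?_, ?_,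
    fun m => ?_⟩
  · exact sdiff_le_sdiff_right (biSup_mono fun n hn => ⟨hn.1, h.trans hn.2⟩)
  · simp only [_root_.sdiff_eq]
    rw [← iInf_inf]
    exact inf_compl_self _
  · exact sdiff_le_sdiff_right (le_iSup₂_of_le (φ m) ⟨hA m, hφ.id_le m⟩ le_rfl)

theorem exists_partition_infinite {A : Set ℕ} (hA : A.Infinite) (k : ℕ) [NeZero k] :
    ∃ t : ℕ → Fin k, ∀ i, {n ∈ A | t n = i}.Infinite := by
  obtain ⟨φ, hφ, hφA⟩ := Filter.extraction_of_frequently_atTop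
    (Nat.frequently_atTop_iff_infinite.2 hA)
  -- The class of `n ∈ A` is its index in the enumeration `φ`, modulo `k`.
  refine ⟨fun n => Fin.ofNat k (Function.invFun φ n), fun i => ?_⟩
  refine (infinite_range_of_injective (f := fun j => φ (k * j + i)) fun j j' h => ?_).mono ?_
  · have := hφ.injective h
    exact Nat.eq_of_mul_eq_mul_left (NeZero.pos k) (by omega)
  · rintro _ ⟨j, rfl⟩
    refine ⟨hφA _, ?_⟩
    change Fin.ofNat k (Function.invFun φ (φ (k * j + i))) = i
    rw [Function.leftInverse_invFun hφ.injective]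
    ext
    simp [Nat.mod_eq_of_lt i.2]

/-! ### Uniform control of finite joins -/

/-- If no `V` works, choose bad `k`-tuples so small that joins of one coordinate per tuple stay in
`U`. Along a stable set, a selection using each coordinate infinitely often has a join above all
coordinatewise limits superior, which puts their join `l` in `O`. The tuples' joins exceed `l` only
by errors tending to `⊥`, so some of them lie in `O`, a contradiction. -/
theorem exists_isLowerNhd_iSup_mem (hB : CCC B) (hsep : inseparableFromBot B ⊆ {⊥})
    {U O : Set B} (hU : IsLowerNhd U) (hO : IsLowerNhd O) (hUO : closure U ⊆ O) (k : ℕ)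
    [NeZero k] : ∃ V, IsLowerNhd V ∧ ∀ v : Fin k → B, (∀ i, v i ∈ V) → ⨆ i, v i ∈ O := by
  by_contra! hV
  have step : ∀ S : {S : Set B // S.Finite ∧ S ⊆ U}, ∃ v : Fin k → B,
      (∀ s ∈ (S : Set B), ∀ i, s ⊔ v i ∈ U) ∧ ⨆ i, v i ∉ O := by
    intro S
    obtain ⟨V, hVn, h⟩ := hU.exists_sup_mem hB hsep S.2.1 S.2.2
    obtain ⟨v, hv, hvO⟩ := hV V hVn
    exact ⟨v, fun s hs i => h s hs _ (hv i), hvO⟩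
  choose g hg hgO using step
  let next : {S : Set B // S.Finite ∧ S ⊆ U} → {S : Set B // S.Finite ∧ S ⊆ U} := fun S =>
    ⟨image2 (fun s i => s ⊔ g S i) (S : Set B) Set.univ, S.2.1.image2 _ finite_univ, by
      rintro _ ⟨s, hs, i, -, rfl⟩
      exact hg S s hs i⟩
  -- `S n` collects all joins of one coordinate from each of the first `n` tuples.
  let S : ℕ → {S : Set B // S.Finite ∧ S ⊆ U} := fun n =>
    Nat.rec ⟨{⊥}, finite_singleton _, by simpa using hU.bot_mem⟩ (fun _ S => next S) n
  set v : ℕ → Fin k → B := fun n => g (S n) with hv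
  have hsel : ∀ (t : ℕ → Fin k) (n : ℕ),
      partialSups (fun n => v n (t n)) n ∈ (S (n + 1) : Set B) := by
    intro t n
    induction n with
    | zero => exact ⟨⊥, rfl, t 0, mem_univ _, by simp [hv, S]⟩
    | succ n ih =>
      rw [partialSups_add_one]
      exact ⟨_, ih, t (n + 1), mem_univ _, rfl⟩
  obtain ⟨A, hA, hstable⟩ := hB.exists_stable fun i n => v n i
  obtain ⟨t, ht⟩ := exists_partition_infinite hA k
  have hy : ⨆ n, v n (t n) ∈ closure U :=
    iSup_mem_of_isClosed isClosed_closure fun n => subset_closure ((S (n + 1)).2.2 (hsel t n))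
  set l : B := ⨆ i, limsupOn (fun n => v n i) A with hl
  have hlO : l ∈ O := by
    refine hO.isLowerSet (iSup_le fun i => ?_) (hUO hy)
    -- Stability allows the `i`-th limit superior to be computed on the piece where `t` selects `i`.
    rw [← hstable i _ (sep_subset _ _) (ht i)]
    refine (limsupOn_le_iSup _ _).trans (iSup₂_le fun n hn => ?_)
    rw [← hn.2]
    exact le_iSup (fun n => v n (t n)) n
  obtain ⟨φ, hφ, hφA⟩ := Filter.extraction_of_frequently_atTop
    (Nat.frequently_atTop_iff_infinite.2 hA)
  have hconv : ConvergesTo (fun n => (⨆ i, v (φ n) i \ limsupOn (fun n => v n i) A) ⊔ l) l := by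
    have := ConvergesToZero.iSup fun i =>
      convergesToZero_sdiff_limsupOn (fun n => v n i) hφ hφA
    simpa using (convergesTo_bot_iff.2 this).sup_const l
  obtain ⟨n, hn⟩ := (hconv.eventually_mem hO.isOpen hlO).exists
  refine hgO (S (φ n)) (hO.isLowerSet (iSup_le fun i => ?_) hn)
  calc v (φ n) i ≤ v (φ n) i \ limsupOn (fun n => v n i) A ⊔ limsupOn (fun n => v n i) A := by
        rw [sdiff_sup_self]; exact le_sup_left
    _ ≤ _ := sup_le_sup (le_iSup (fun i => v (φ n) i \ limsupOn (fun n => v n i) A) i)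
        (le_iSup (fun i => limsupOn (fun n => v n i) A) i)

theorem exists_isLowerNhd_joins (hB : CCC B) (hsep : inseparableFromBot B ⊆ {⊥}) {U : Set B}
    (hU : IsLowerNhd U) : ∃ V, IsLowerNhd V ∧ ∀ a ∈ joins V, ∀ b ∈ joins V, ∀ c ∈ joins V,
      a ⊔ b ⊔ c ∈ joins U := by
  -- Three joins of two elements each make six elements.
  obtain ⟨V, hV, h⟩ := exists_isLowerNhd_iSup_mem hB hsep hU (isLowerNhd_joins hU)
    (closure_subset_joins hU) 6
  refine ⟨V, hV, ?_⟩
  rintro _ ⟨a, ha, a', ha', rfl⟩ _ ⟨b, hb, b', hb', rfl⟩ _ ⟨c, hc, c', hc', rfl⟩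
  have hv : ∀ i, (![a, a', b, b', c, c'] : Fin 6 → B) i ∈ V := by
    intro i
    fin_cases i <;> assumption
  refine (isLowerNhd_joins hU).isLowerSet ?_ (h _ hv)
  exact sup_le (sup_le
    (sup_le (le_iSup ![a, a', b, b', c, c'] 0) (le_iSup ![a, a', b, b', c, c'] 1))
    (sup_le (le_iSup ![a, a', b, b', c, c'] 2) (le_iSup ![a, a', b, b', c, c'] 3)))
    (sup_le (le_iSup ![a, a', b, b', c, c'] 4) (le_iSup ![a, a', b, b', c, c'] 5))

/-! ### From a sequence of neighbourhoods to a submeasure -/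

/-- The join of the elements of a list. -/
def listJoin (l : List B) : B := l.foldr (· ⊔ ·) ⊥

@[simp] theorem listJoin_nil : listJoin ([] : List B) = ⊥ := rfl

@[simp] theorem listJoin_cons (a : B) (l : List B) : listJoin (a :: l) = a ⊔ listJoin l := rfl

@[simp] theorem listJoin_append (l l' : List B) :
    listJoin (l ++ l') = listJoin l ⊔ listJoin l' := by
  induction l with
  | nil => simp
  | cons a l ih => simp [ih, sup_assoc]

/-- The entry `a` is the one at which the partial sums first reach `c`. -/
theorem exists_split_of_le_sum {α : Type*} {f : α → ℝ} (l : List α)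
    (hl : l ≠ []) {c : ℝ} (hc : 0 ≤ c) (hcl : c ≤ (l.map f).sum) :
    ∃ l₁ a l₂, l = l₁ ++ a :: l₂ ∧ (l₁.map f).sum ≤ c ∧
      (l₂.map f).sum ≤ (l.map f).sum - c := by
  induction l generalizing c with
  | nil => exact (hl rfl).elim
  | cons a l ih =>
    by_cases h : c ≤ f a
    · exact ⟨[], a, l, rfl, by simpa using hc, by simp; linarith⟩
    · push Not at h
      have hsum : c - f a ≤ (l.map f).sum := by simp at hcl; linarith
      have hne : l ≠ [] := by
        rintro rfl
        simp at hsum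
        linarith
      obtain ⟨l₁, b, l₂, rfl, h₁, h₂⟩ := ih hne (sub_nonneg.2 h.le) hsum
      refine ⟨a :: l₁, b, l₂, rfl, ?_, ?_⟩
      · simp; linarith
      · simp at h₂ ⊢; linarith

theorem sum_map_nonneg {α : Type*} {f : α → ℝ} (hf : ∀ x, 0 ≤ f x) (l : List α) : 0 ≤ (l.map f).sum :=
  List.sum_nonneg (by simpa using fun x _ => hf x)

/-- Frink's chaining inequality. -/
theorem le_two_mul_sum_of_sup_le {f : B → ℝ} (hf : ∀ x, 0 ≤ f x) (h0 : f ⊥ = 0)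
    (h3 : ∀ x y z c, f x ≤ c → f y ≤ c → f z ≤ c → f (x ⊔ y ⊔ z) ≤ 2 * c) (l : List B) :
    f (listJoin l) ≤ 2 * (l.map f).sum := by
  induction hn : l.length using Nat.strong_induction_on generalizing l with
  | _ n ih =>
    by_cases hl : l = []
    · simp [hl, h0]
    have hpos := sum_map_nonneg hf
    -- Cutting at half the total leaves outer lists whose values are at most the total, by
    -- induction; the middle entry is also at most the total, and `h3` costs the single factor 2.
    obtain ⟨l₁, a, l₂, hl', h₁, h₂⟩ := exists_split_of_le_sum (f := f) l hl
      (c := (l.map f).sum / 2) (by linarith [hpos l]) (by linarith [hpos l])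
    have e₁ := ih _ (by rw [← hn, hl']; simp) l₁ rfl
    have e₂ := ih _ (by rw [← hn, hl']; simp; omega) l₂ rfl
    have ha : f a ≤ (l.map f).sum := by
      rw [hl']
      simp
      linarith [hpos l₁, hpos l₂]
    have := h3 (listJoin l₁) a (listJoin l₂) (l.map f).sum (by linarith) ha (by linarith)
    conv_lhs => rw [hl']
    rwa [listJoin_append, listJoin_cons, ← sup_assoc]

/-- The largest monotone subadditive function below `f`. -/
noncomputable def subadditiveHull (f : B → ℝ) (x : B) : ℝ :=
  sInf {r | ∃ l : List B, x ≤ listJoin l ∧ r = (l.map f).sum}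

theorem subadditiveHull_le {f : B → ℝ} (hf : ∀ x, 0 ≤ f x) {x : B} {l : List B}
    (h : x ≤ listJoin l) : subadditiveHull f x ≤ (l.map f).sum :=
  csInf_le ⟨0, by rintro _ ⟨l, -, rfl⟩; exact sum_map_nonneg hf l⟩ ⟨l, h, rfl⟩

theorem le_subadditiveHull {f : B → ℝ} {x : B} {c : ℝ}
    (h : ∀ l : List B, x ≤ listJoin l → c ≤ (l.map f).sum) : c ≤ subadditiveHull f x :=
  le_csInf ⟨_, [x], by simp, rfl⟩ (by rintro _ ⟨l, hl, rfl⟩; exact h l hl)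

/-- Concatenating covers gives subadditivity; continuity is inherited from `f`, which dominates the
hull. -/
theorem isMaharamSubmeasure_subadditiveHull {f : B → ℝ} (hf : ∀ x, 0 ≤ f x) (h0 : f ⊥ = 0)
    (hlim : ∀ a : ℕ → B, ConvergesTo a ⊥ → Tendsto (fun n => f (a n)) atTop (𝓝 0)) :
    IsMaharamSubmeasure (subadditiveHull f) := by
  have hnn : ∀ x, 0 ≤ subadditiveHull f x := fun x =>
    le_subadditiveHull fun l _ => sum_map_nonneg hf l
  have hle : ∀ x, subadditiveHull f x ≤ f x := fun x => by
    simpa using subadditiveHull_le hf (x := x) (l := [x]) (by simp)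
  refine ⟨hnn, le_antisymm (h0 ▸ hle ⊥) (hnn _), fun x y hxy => ?_, fun x y => ?_,
    fun a ha ha0 => ?_⟩
  · exact le_subadditiveHull fun l hl => subadditiveHull_le hf (hxy.trans hl)
  · rw [← sub_le_iff_le_add]
    refine le_subadditiveHull fun l hl => ?_
    rw [sub_le_comm]
    refine le_subadditiveHull fun l' hl' => ?_
    rw [sub_le_iff_le_add, add_comm, ← List.sum_append, ← List.map_append]
    refine subadditiveHull_le hf ?_
    rw [listJoin_append]
    exact sup_le_sup hl hl'
  · exact squeeze_zero (fun n => hnn _) (fun n => hle _)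
      (hlim a (convergesTo_bot_of_antitone ha ha0))

open Classical in
/-- `(1 / 2) ^ n` for the least `n` such that `x ∉ W n`, and `0` if there is none. -/
noncomputable def nhdRank {α : Type*} (W : ℕ → Set α) (x : α) : ℝ :=
  if h : ∃ n, x ∉ W n then (1 / 2) ^ Nat.find h else 0

theorem nhdRank_nonneg {α : Type*} (W : ℕ → Set α) (x : α) : 0 ≤ nhdRank W x := by
  unfold nhdRank
  split_ifs <;> positivity

theorem nhdRank_le_pow_iff {α : Type*} {W : ℕ → Set α} {x : α} {n : ℕ} :
    nhdRank W x ≤ (1 / 2) ^ n ↔ ∀ k < n, x ∈ W k := by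
  classical
  unfold nhdRank
  split_ifs with h
  · rw [pow_le_pow_iff_right_of_lt_one₀ (by norm_num) (by norm_num), Nat.le_find_iff]
    simp
  · push Not at h
    exact ⟨fun _ k _ => h k, fun _ => by positivity⟩

theorem nhdRank_eq_zero_or {α : Type*} (W : ℕ → Set α) (x : α) :
    nhdRank W x = 0 ∨ ∃ n, nhdRank W x = (1 / 2) ^ n := by
  unfold nhdRank
  split_ifs
  exacts [Or.inr ⟨_, rfl⟩, Or.inl rfl]

theorem nhdRank_eq_zero_iff {α : Type*} {W : ℕ → Set α} {x : α} : nhdRank W x = 0 ↔ ∀ n, x ∈ W n := by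
  classical
  unfold nhdRank
  split_ifs with h
  · obtain ⟨n, hn⟩ := h
    exact ⟨fun h => absurd h (by positivity), fun h => absurd (h n) hn⟩
  · push Not at h
    simpa using h

theorem nhdRank_sup_le {W : ℕ → Set B}
    (hW : ∀ n, ∀ a ∈ W (n + 1), ∀ b ∈ W (n + 1), ∀ c ∈ W (n + 1), a ⊔ b ⊔ c ∈ W n)
    {x y z : B} {c : ℝ} (hx : nhdRank W x ≤ c) (hy : nhdRank W y ≤ c) (hz : nhdRank W z ≤ c) :
    nhdRank W (x ⊔ y ⊔ z) ≤ 2 * c := by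
  -- The bound `c` is replaced by the largest of the three ranks, which is 0 or a power of `1 / 2`.
  obtain ⟨w, hw, hxw, hyw, hzw⟩ : ∃ w, nhdRank W w ≤ c ∧ nhdRank W x ≤ nhdRank W w ∧
      nhdRank W y ≤ nhdRank W w ∧ nhdRank W z ≤ nhdRank W w := by
    rcases le_total (nhdRank W x) (nhdRank W y) with h | h <;>
    rcases le_total (nhdRank W y) (nhdRank W z) with h' | h' <;>
    rcases le_total (nhdRank W x) (nhdRank W z) with h'' | h''
    · exact ⟨z, hz, h'', h', le_rfl⟩
    · exact ⟨z, hz, h.trans h', h', le_rfl⟩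
    · exact ⟨y, hy, h, le_rfl, h'⟩
    · exact ⟨y, hy, h, le_rfl, h'⟩
    · exact ⟨z, hz, h'', h', le_rfl⟩
    · exact ⟨x, hx, le_rfl, h, h''⟩
    · exact ⟨x, hx, le_rfl, h, h'.trans h⟩
    · exact ⟨x, hx, le_rfl, h, h''⟩
  refine le_trans ?_ (mul_le_mul_of_nonneg_left hw zero_le_two)
  rcases nhdRank_eq_zero_or W w with h | ⟨n, h⟩
  · have aux : ∀ v, nhdRank W v ≤ nhdRank W w → ∀ n, v ∈ W n := fun v hv =>
      nhdRank_eq_zero_iff.1 (le_antisymm (h ▸ hv) (nhdRank_nonneg W v))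
    rw [h, mul_zero]
    exact (nhdRank_eq_zero_iff.2 fun n =>
      hW n _ (aux x hxw _) _ (aux y hyw _) _ (aux z hzw _)).le
  · rw [h, nhdRank_le_pow_iff] at hxw hyw hzw
    rw [h]
    cases n with
    | zero =>
      refine (nhdRank_le_pow_iff (n := 0).2 (by simp)).trans (by norm_num)
    | succ n =>
      rw [show (2 : ℝ) * (1 / 2) ^ (n + 1) = (1 / 2) ^ n by ring, nhdRank_le_pow_iff]
      exact fun k hk => hW k _ (hxw _ (by omega)) _ (hyw _ (by omega)) _ (hzw _ (by omega))

theorem tendsto_nhdRank {W : ℕ → Set B} (hW : ∀ n, IsLowerNhd (W n)) {a : ℕ → B}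
    (ha : ConvergesTo a ⊥) : Tendsto (fun n => nhdRank W (a n)) atTop (𝓝 0) := by
  refine Metric.tendsto_atTop.2 fun ε hε => ?_
  obtain ⟨m, hm⟩ := exists_pow_lt_of_lt_one hε (by norm_num : (1 / 2 : ℝ) < 1)
  have h : ∀ᶠ n in atTop, ∀ k ∈ Finset.range m, a n ∈ W k :=
    (Finset.eventually_all _).2 fun k _ => ha.eventually_mem (hW k).isOpen (hW k).bot_mem
  obtain ⟨N, hN⟩ := eventually_atTop.1 h
  refine ⟨N, fun n hn => ?_⟩
  rw [Real.dist_eq, sub_zero, abs_of_nonneg (nhdRank_nonneg _ _)]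
  exact (nhdRank_le_pow_iff.2 fun k hk => hN n hn k (Finset.mem_range.2 hk)).trans_lt hm

theorem exists_isMaharamSubmeasure_ne_zero (hB : CCC B) (hsep : inseparableFromBot B ⊆ {⊥})
    {a : B} (ha : a ≠ ⊥) : ∃ μ : B → ℝ, IsMaharamSubmeasure μ ∧ μ a ≠ 0 := by
  obtain ⟨U, hU, h0, haU⟩ : ∃ U : Set B, IsOpen U ∧ ⊥ ∈ U ∧ a ∉ closure U := by
    by_contra! h
    exact ha (hsep h)
  obtain ⟨V, hV, hVU⟩ := exists_isLowerNhd_subset hB hsep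
    (hU.inter (isClosed_closure.isOpen_compl.preimage (continuous_symmDiff_const a)))
    (show ⊥ ∈ U ∩ (fun x => symmDiff x a) ⁻¹' (closure U)ᶜ from ⟨h0, by simpa using haU⟩)
  -- If `a = u ⊔ v`, translating `v \ u` by `a` gives an element below `u`, hence in `U`, whereas
  -- `V` was chosen so that its translates by `a` avoid `closure U`.
  have haV : a ∉ joins V := by
    rintro ⟨u, hu, v, hv, rfl⟩
    refine (hVU (hV.isLowerSet (sdiff_le : v \ u ≤ v) hv)).2 (subset_closure (hVU ?_).1)
    have : symmDiff (v \ u) (u ⊔ v) ≤ u := by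
      rw [symmDiff_of_le (sdiff_le.trans le_sup_right), sdiff_le_iff, sup_comm (v \ u),
        sup_sdiff_self_right]
    exact hV.isLowerSet this hu
  choose next hnext hjoins using fun U : {U : Set B // IsLowerNhd U} =>
    exists_isLowerNhd_joins hB hsep U.2
  let S : ℕ → {U : Set B // IsLowerNhd U} := fun n =>
    Nat.rec ⟨V, hV⟩ (fun _ U => ⟨next U, hnext U⟩) n
  set W : ℕ → Set B := fun n => joins (S n).1 with hWdef
  have hW : ∀ n, IsLowerNhd (W n) := fun n => isLowerNhd_joins (S n).2
  have hW3 : ∀ n, ∀ a ∈ W (n + 1), ∀ b ∈ W (n + 1), ∀ c ∈ W (n + 1), a ⊔ b ⊔ c ∈ W n :=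
    fun n => hjoins (S n)
  have hbot : nhdRank W ⊥ = 0 := nhdRank_eq_zero_iff.2 fun n => (hW n).bot_mem
  refine ⟨_, isMaharamSubmeasure_subadditiveHull (nhdRank_nonneg W) hbot
    fun a ha => tendsto_nhdRank hW ha, fun h => ?_⟩
  have hmono : ∀ x y, x ≤ y → nhdRank W x ≤ nhdRank W y := by
    intro x y hxy
    rcases nhdRank_eq_zero_or W y with h | ⟨n, h⟩
    · rw [h, nhdRank_eq_zero_iff.2 fun n => (hW n).isLowerSet hxy (nhdRank_eq_zero_iff.1 h n)]
    · rw [h, nhdRank_le_pow_iff]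
      exact fun k hk => (hW k).isLowerSet hxy (nhdRank_le_pow_iff.1 h.le k hk)
  -- Chaining shows that passing to the hull loses at most a factor 2, so the value at `a` stays
  -- nonzero.
  have hle : nhdRank W a / 2 ≤ subadditiveHull (nhdRank W) a := by
    refine le_subadditiveHull fun l hl => ?_
    have := le_two_mul_sum_of_sup_le (nhdRank_nonneg W) hbot
      (fun x y z c => nhdRank_sup_le hW3) l
    linarith [hmono _ _ hl]
  have hzero : nhdRank W a = 0 := le_antisymm (by linarith) (nhdRank_nonneg W a)
  exact haV (nhdRank_eq_zero_iff.1 hzero 0)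

/-! ### Exhaustion -/

/-- The join `e` of all null elements is itself null, by ccc, subadditivity and continuity; `a \ e`
is then nonzero and contains no nonzero null element. -/
theorem IsMaharamSubmeasure.exists_pos_below (hB : CCC B) {μ : B → ℝ} (hμ : IsMaharamSubmeasure μ)
    {a : B} (ha : μ a ≠ 0) : ∃ c ≤ a, c ≠ ⊥ ∧ ∀ x ≤ c, μ x = 0 → x = ⊥ := by
  set e : B := sSup {x | μ x = 0} with he
  have hsup : ∀ x y, μ x = 0 → μ y = 0 → μ (x ⊔ y) = 0 := fun x y hx hy =>
    le_antisymm (by simpa [hx, hy] using hμ.map_sup_le x y) (hμ.nonneg _)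
  have hee : μ e = 0 := by
    obtain ⟨t, ht, hte⟩ := hB.exists_iSup_eq (S := {x | μ x = 0}) ⟨⊥, hμ.map_bot⟩
    have hp : ∀ n, μ (partialSups t n) = 0 := by
      intro n
      induction n with
      | zero => simpa using ht 0
      | succ n ih => rw [partialSups_add_one]; exact hsup _ _ ih (ht _)
    have hlim := hμ.continuous (fun n => e \ partialSups t n)
      (fun i j h => sdiff_le_sdiff_left ((partialSups t).monotone h)) (by
        rw [he, ← hte, ← iSup_partialSups_eq t]
        exact iInf_sdiff_iSup _)
    refine le_antisymm (ge_of_tendsto' hlim fun n => ?_) (hμ.nonneg _)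
    calc μ e ≤ μ (partialSups t n ⊔ e \ partialSups t n) := by
          refine hμ.mono _ _ ?_
          rw [sup_sdiff_self_right]
          exact le_sup_right
      _ ≤ _ := by simpa [hp] using hμ.map_sup_le (partialSups t n) (e \ partialSups t n)
  refine ⟨a \ e, sdiff_le, fun h => ha ?_, fun x hx hx0 => ?_⟩
  · exact le_antisymm (hee ▸ hμ.mono _ _ (sdiff_eq_bot_iff.1 h)) (hμ.nonneg _)
  · exact disjoint_self.1 (disjoint_sdiff_self_left.mono hx (le_sSup hx0))

theorem carriesStrictlyPositiveMaharam_of_inseparable_subset (hB : CCC B)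
    (hsep : inseparableFromBot B ⊆ {⊥}) : CarriesStrictlyPositiveMaharam B := by
  set S : Set B := {c | ∃ μ : B → ℝ, IsMaharamSubmeasure μ ∧ ∀ x ≤ c, μ x = 0 → x = ⊥} with hS
  have hbot : ⊥ ∈ S := by
    refine ⟨fun _ => 0, ⟨fun _ => le_rfl, rfl, fun _ _ _ => le_rfl, fun _ _ => by simp,
      fun _ _ _ => tendsto_const_nhds⟩, fun x hx _ => le_bot_iff.1 hx⟩
  have htop : sSup S = ⊤ := by
    by_contra h
    obtain ⟨μ, hμ, hμa⟩ := exists_isMaharamSubmeasure_ne_zero hB hsep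
      (a := (sSup S)ᶜ) (by simpa using h)
    obtain ⟨c, hc, hc0, hpos⟩ := hμ.exists_pos_below hB hμa
    have hcS : c ∈ S := ⟨μ, hμ, hpos⟩
    exact hc0 (disjoint_self.1 (disjoint_compl_right.mono (le_sSup hcS) hc))
  obtain ⟨t, ht, htS⟩ := hB.exists_iSup_eq (S := S) ⟨⊥, hbot⟩
  choose μ hμ hpos using ht
  have hnn : ∀ x n, 0 ≤ (1 / 2 : ℝ) ^ n * min (μ n x) 1 := fun x n =>
    mul_nonneg (by positivity) (le_min ((hμ n).nonneg x) zero_le_one)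
  have hle : ∀ x n, (1 / 2 : ℝ) ^ n * min (μ n x) 1 ≤ (1 / 2 : ℝ) ^ n := fun x n =>
    mul_le_of_le_one_right (by positivity) (min_le_right _ _)
  have hs : ∀ x, Summable fun n => (1 / 2 : ℝ) ^ n * min (μ n x) 1 := fun x =>
    Summable.of_nonneg_of_le (hnn x) (hle x) summable_geometric_two
  -- Truncation at 1 preserves subadditivity and lets the geometric weights dominate the series,
  -- which gives continuity by dominated convergence.
  refine ⟨fun x => ∑' n, (1 / 2 : ℝ) ^ n * min (μ n x) 1, ⟨fun x => tsum_nonneg (hnn x), ?_,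
    fun x y hxy => ?_, fun x y => ?_, fun a ha ha0 => ?_⟩, fun x hx => ?_⟩
  · simp [(hμ _).map_bot]
  · refine (hs x).tsum_le_tsum (fun n => ?_) (hs y)
    gcongr
    exact (hμ n).mono _ _ hxy
  · rw [← (hs x).tsum_add (hs y)]
    refine (hs _).tsum_le_tsum (fun n => ?_) ((hs x).add (hs y))
    rw [← mul_add]
    refine mul_le_mul_of_nonneg_left ?_ (by positivity)
    have h := (hμ n).map_sup_le x y
    have hx := (hμ n).nonneg x
    have hy := (hμ n).nonneg y
    rcases le_total (μ n x) 1 with h1 | h1 <;> rcases le_total (μ n y) 1 with h2 | h2 <;>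
      simp only [min_eq_left, min_eq_right, h1, h2]
    · exact (min_le_left _ _).trans h
    all_goals exact (min_le_right _ _).trans (by linarith)
  · have h : Tendsto (fun k => ∑' n, (1 / 2 : ℝ) ^ n * min (μ n (a k)) 1) atTop
        (𝓝 (∑' _ : ℕ, (0 : ℝ))) := by
      refine tendsto_tsum_of_dominated_convergence summable_geometric_two (fun n => ?_)
        (Eventually.of_forall fun k n => ?_)
      · have := (((hμ n).continuous a ha ha0).min
          (tendsto_const_nhds (x := (1 : ℝ)))).const_mul ((1 / 2 : ℝ) ^ n)
        simpa using this
      · rw [Real.norm_of_nonneg (hnn _ _)]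
        exact hle _ _
    simpa using h
  · have hz : ∀ n, μ n x = 0 := by
      intro n
      have h := congrFun ((hasSum_zero_iff_of_nonneg (hnn x)).1 ((hs x).hasSum_iff.2 hx)) n
      have h' : min (μ n x) 1 = 0 := by simpa using h
      rcases min_choice (μ n x) 1 with h1 | h1
      · exact h1.symm.trans h'
      · exact absurd (h1.symm.trans h') one_ne_zero
    have hx' : ∀ n, t n ⊓ x = ⊥ := fun n =>
      hpos n _ inf_le_left (le_antisymm (hz n ▸ (hμ n).mono _ _ inf_le_right) ((hμ n).nonneg _))
    rw [← top_inf_eq x, ← htop, ← htS, iSup_inf_eq]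
    simp [hx']

end

/-! ### Relative algebras -/

section

variable {B : Type*} [CompleteBooleanAlgebra B]

theorem CCC.relative (hB : CCC B) (a : B) : CCC (Iic a) := by
  intro A h1 h2
  refine countable_of_injective_of_countable_image (f := Subtype.val)
    Subtype.val_injective.injOn (hB _ ?_ ?_)
  · rintro _ ⟨x, hx, rfl⟩ h
    exact h1 x hx (Subtype.ext h)
  · rintro _ ⟨x, hx, rfl⟩ _ ⟨y, hy, rfl⟩ hxy
    exact congrArg Subtype.val (h2 x hx y hy fun h => hxy (congrArg _ h))

theorem coe_iInf_relative {a : B} (b : ℕ → Iic a) (h : ⨅ n, b n = ⊥) : ⨅ n, (b n : B) = ⊥ := by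
  refine le_bot_iff.1 ?_
  have hle : (⟨⨅ n, (b n : B), (iInf_le _ 0).trans (b 0).2⟩ : Iic a) ≤ ⨅ n, b n :=
    le_iInf fun n => iInf_le (fun n => (b n : B)) n
  rw [h] at hle
  exact hle

theorem iInf_relative {a : B} (b : ℕ → Iic a) (h : ⨅ n, (b n : B) = ⊥) : ⨅ n, b n = ⊥ := by
  refine le_bot_iff.1 (show ((⨅ n, b n : Iic a) : B) ≤ ⊥ from ?_)
  rw [← h]
  exact le_iInf fun n => iInf_le b n

theorem continuous_coe_relative (a : B) :
    @Continuous _ _ (orderSeqTopology (Iic a)) (orderSeqTopology B) fun x : Iic a => (x : B) := by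
  refine continuous_of_convergesTo ?_
  rintro u x ⟨b, hb, hb0, hub⟩
  exact ⟨fun n => b n, fun i j h => hb h, coe_iInf_relative b hb0, fun n => hub n⟩

theorem continuous_inf_relative (a : B) :
    @Continuous _ _ (orderSeqTopology B) (orderSeqTopology (Iic a))
      fun x : B => (⟨x ⊓ a, inf_le_right⟩ : Iic a) := by
  refine continuous_of_convergesTo fun u x h => ?_
  obtain ⟨b, hb, hb0, hub⟩ := h.inf_const a
  refine ⟨fun n => ⟨b n ⊓ a, inf_le_right⟩, fun i j h => inf_le_inf_right a (hb h), ?_,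
    fun n => ?_⟩
  · refine iInf_relative _ (le_bot_iff.1 (hb0 ▸ iInf_mono fun n => inf_le_left))
  · exact le_inf (hub n) (sup_le (sdiff_le.trans inf_le_right) (sdiff_le.trans inf_le_right))

end

end BoolSeq

/-! ### The decomposition and the dichotomy -/

open BoolSeq in
/-- Decomposition of a complete ccc Boolean algebra, and the resulting dichotomy. -/
theorem mainTheorem1 (B : Type*) [CompleteBooleanAlgebra B] (hB : BoolSeq.CCC B) :
    (∃ d m : B, d ⊓ m = ⊥ ∧ d ⊔ m = ⊤ ∧
      BoolSeq.EveryNonemptyOpenDense (Set.Iic d) ∧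
      BoolSeq.CarriesStrictlyPositiveMaharam (Set.Iic m)) ∧
    (((∃ a : B, a ≠ ⊥ ∧ BoolSeq.CarriesStrictlyPositiveMaharam (Set.Iic a)) ∧
        (∃ μ : B → ℝ, BoolSeq.IsMaharamSubmeasure μ ∧ ∃ x, μ x ≠ 0)) ∨
      BoolSeq.EveryNonemptyOpenDense B) := by
  set d : B := sSup (inseparableFromBot B) with hd
  have hdmem : d ∈ inseparableFromBot B := sSup_mem_inseparableFromBot hB
  have hm : CarriesStrictlyPositiveMaharam (Set.Iic dᶜ) := by
    refine carriesStrictlyPositiveMaharam_of_inseparable_subset (hB.relative _) fun x hx => ?_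
    -- An element below `dᶜ` that is inseparable from `⊥` there is so in `B` too, hence lies below
    -- `d` as well and vanishes.
    have h : (x : B) ∈ inseparableFromBot B :=
      map_mem_inseparableFromBot (continuous_coe_relative dᶜ) rfl hx
    exact Subtype.ext (disjoint_self.1 (disjoint_compl_right.mono (le_sSup h) x.2))
  refine ⟨⟨d, dᶜ, inf_compl_self d, sup_compl_eq_top, ?_, hm⟩, ?_⟩
  · refine everyNonemptyOpenDense_of_top_mem ?_
    -- The continuous map `x ↦ x ⊓ d` carries inseparability of `d` in `B` to the top of the
    -- relative algebra.
    have h := map_mem_inseparableFromBot (continuous_inf_relative d)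
      (Subtype.ext (bot_inf_eq d)) hdmem
    convert h
    exact Subtype.ext (inf_idem d).symm
  · by_cases h : d = ⊤
    · exact Or.inr (everyNonemptyOpenDense_of_top_mem (h ▸ hdmem))
    · have hne : dᶜ ≠ ⊥ := by simpa using h
      refine Or.inl ⟨⟨dᶜ, hne, hm⟩, ?_⟩
      obtain ⟨μ, hμ, hpos⟩ := hm
      refine ⟨fun x => μ ⟨x ⊓ dᶜ, inf_le_right⟩, ⟨fun x => hμ.nonneg _, ?_, fun x y hxy => ?_,
        fun x y => ?_, fun a ha ha0 => ?_⟩, dᶜ, fun h => hne ?_⟩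
      · convert hμ.map_bot
        exact Subtype.ext (bot_inf_eq _)
      · exact hμ.mono _ _ (inf_le_inf_right dᶜ hxy)
      · convert hμ.map_sup_le _ _
        exact Subtype.ext (inf_sup_right _ _ _)
      · refine hμ.continuous _ (fun i j h => inf_le_inf_right dᶜ (ha h)) (iInf_relative _ ?_)
        exact le_bot_iff.1 (ha0 ▸ iInf_mono fun n => inf_le_left)
      · simpa using congrArg Subtype.val (hpos _ h)
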